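/- Let $Z$ be a compact (Hausdorff) abelian group with Haar probability measure $\mu$, let $d\ge 1$ be an integer, and put $p=2^{d-1}$ and $q=2^{d-1}/(2^{d-1}-1)$ (so $q=\infty$ when $d=1$). All functions are real valued, $\mathbb E$ denotes integration against the Haar probability measure of the indicated power of $Z$, and for $\vec\epsilon\in\{0,1\}^d$ and $\vec t\in Z^d$ we write $\vec\epsilon\cdot\vec t=\epsilon_1t_1+\dots+\epsilon_dt_d$. For $f\in L^{p}(\mu)$ define $$\|f\|_{U(d)}=\Bigl(\mathbb E_{x\in Z,\ \vec t\in Z^d}\prod_{\vec\epsilon\in\{0,1\}^d}f(x+\vec\epsilon\cdot\vec t)\Bigr)^{1/2^d},\qquad \mathcal D_df(x)=\mathbb E_{\vec t\in Z^d}\prod_{\vec\epsilon\in\{0,1\}^d,\ \vec\epsilon\ne\vec 0}f(x+\vec\epsilon\cdot\vec t).$$ A function $g\in L^{q}(\mu)$ is called anti-uniform of level $d$ if $$\|g\|_{U(d)}^*:=\sup\Bigl\{\Bigl|\int_Z g\,f\,d\mu\Bigr| : f\in L^{p}(\mu),\ \|f\|_{U(d)}\le 1\Bigr\}<+\infty .$$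 Then $\mathcal D_df\in L^q(\mu)$ for every $f\in L^p(\mu)$, and the unit ball $\{g\in L^q(\mu): g \text{ is anti-uniform of level } d,\ \|g\|_{U(d)}^*\le 1\}$ of the anti-uniform space of level $d$ is equal to the closed convex hull, in $L^{q}(\mu)$ with its norm topology, of the set $$\bigl\{\mathcal D_df : f\in L^{p}(\mu),\ \|f\|_{U(d)}\le 1\bigr\}.$$ -/

import Mathlib

open MeasureTheory TopologicalSpace
open scoped ENNReal

namespace Gowers

noncomputable section

/-- The Haar probability measure of a compact abelian group. -/
abbrev haarProb (G : Type*) [AddCommGroup G] [TopologicalSpace G] [IsTopologicalAddGroup G]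
    [CompactSpace G] [MeasurableSpace G] [BorelSpace G] : Measure G :=
  Measure.addHaarMeasure (⊤ : PositiveCompacts G)

/-- The expectation `E_{g ∈ G} F g`: the integral of `F` against the Haar probability measure on
the Borel sets of the compact abelian group `G`. It is used for the powers of a compact group `Z`,
whose Haar probability measure is the product of copies of that of `Z`; taking the Borel sets of
the power (rather than the product of the Borel σ-algebras) gives the right integral also when `Z`
is not second countable. -/
def expect {G : Type*} [AddCommGroup G] [TopologicalSpace G] [IsTopologicalAddGroup G]
    [CompactSpace G] (F : G → ℝ) : ℝ :=
  letI : MeasurableSpace G := borel G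
  haveI : BorelSpace G := ⟨rfl⟩
  ∫ g, F g ∂(haarProb G)

/-- `ε · t = ε₁ t₁ + ⋯ + ε_d t_d` for `ε ∈ {0,1}^d` and `t ∈ Z^d`. -/
def dot {Z : Type*} [AddCommGroup Z] {d : ℕ} (ε : Fin d → Fin 2) (t : Fin d → Z) : Z :=
  ∑ i, (ε i : ℕ) • t i

section

variable {Z : Type*} [AddCommGroup Z] [TopologicalSpace Z] [IsTopologicalAddGroup Z]
  [CompactSpace Z]

/-- The Gowers norm of level `d`:
`‖f‖_{U(d)} = (E_{x ∈ Z, t ∈ Z^d} ∏_{ε ∈ {0,1}^d} f (x + ε · t)) ^ (1 / 2 ^ d)`. -/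
def gowersNorm (d : ℕ) (f : Z → ℝ) : ℝ :=
  (expect fun y : Z × (Fin d → Z) => ∏ ε : Fin d → Fin 2, f (y.1 + dot ε y.2)) ^
    (1 / (2 : ℝ) ^ d)

/-- The dual function of level `d`:
`D_d f (x) = E_{t ∈ Z^d} ∏_{ε ∈ {0,1}^d, ε ≠ 0} f (x + ε · t)`. -/
def dualFun (d : ℕ) (f : Z → ℝ) (x : Z) : ℝ :=
  expect fun t : Fin d → Z => ∏ ε : Fin d → Fin 2 with ε ≠ 0, f (x + dot ε t)

end

/-- The exponent `2 ^ (d - 1)`. -/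
def expP (d : ℕ) : ℝ≥0∞ := 2 ^ (d - 1)

/-- The conjugate exponent `2 ^ (d - 1) / (2 ^ (d - 1) - 1)`, which is `∞` for `d = 1`. -/
def expQ (d : ℕ) : ℝ≥0∞ := 2 ^ (d - 1) / (2 ^ (d - 1) - 1)

instance fact_one_le_expP (d : ℕ) : Fact (1 ≤ expP d) :=
  ⟨one_le_pow_of_one_le' (by norm_num) _⟩

instance fact_one_le_expQ (d : ℕ) : Fact (1 ≤ expQ d) := by
  refine ⟨?_⟩
  unfold expQ
  rw [ENNReal.le_div_iff_mul_le (Or.inr (by simp)) (Or.inr (by simp)), one_mul]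
  exact tsub_le_self

section

variable {Z : Type*} [AddCommGroup Z] [TopologicalSpace Z] [IsTopologicalAddGroup Z]
  [CompactSpace Z] [MeasurableSpace Z] [BorelSpace Z]

/-- The pairing `⟨g ; f⟩ = E_{x ∈ Z} g x * f x`. -/
def pairing (g f : Z → ℝ) : ℝ := ∫ x, g x * f x ∂(haarProb Z)

/-- The values `|⟨g ; f⟩|` for `f ∈ L^{2^{d-1}}` with `‖f‖_{U(d)} ≤ 1`. -/
def dualValues (d : ℕ) (g : Lp ℝ (expQ d) (haarProb Z)) : Set ℝ :=
  {r | ∃ f : Lp ℝ (expP d) (haarProb Z), gowersNorm d f ≤ 1 ∧ r = |pairing g f|}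

/-- `g` is an anti-uniform function of level `d`: it defines a functional on `L^{2^{d-1}}` that is
bounded for the norm `U(d)`. -/
def IsAntiUniform (d : ℕ) (g : Lp ℝ (expQ d) (haarProb Z)) : Prop :=
  BddAbove (dualValues d g)

/-- The anti-uniform norm of level `d` (meaningful for anti-uniform functions). -/
def antiUniformNorm (d : ℕ) (g : Lp ℝ (expQ d) (haarProb Z)) : ℝ :=
  sSup (dualValues d g)

/-- The closed unit ball of the anti-uniform space of level `d`. -/
def antiUniformBall (Z : Type*) [AddCommGroup Z] [TopologicalSpace Z] [IsTopologicalAddGroup Z]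
    [CompactSpace Z] [MeasurableSpace Z] [BorelSpace Z] (d : ℕ) :
    Set (Lp ℝ (expQ d) (haarProb Z)) :=
  {g | IsAntiUniform d g ∧ antiUniformNorm d g ≤ 1}

end

end

end Gowers

set_option linter.unusedSectionVars false

namespace Gowers

noncomputable section

/-! This is a polar-duality argument. Pairing `h` with `D_d f` gives the Gowers form with `h` at the
vertex `0` and `f` at every other vertex. Two facts about this form are used. The
Cauchy-Schwarz-Gowers inequality (`abs_gowersForm_ite_le_one`) bounds it by 1 when both functions
have Gowers norm at most 1, so dual functions lie in the anti-uniform ball, which is closed and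
convex as an intersection of slabs. The bound by the product of the `L^{2^{d-1}}` norms
(`lintegral_prod_le`), with a converse of Hölder's inequality, puts `D_d f` in `L^q`.

For the reverse inclusion with `d ≥ 2`, suppose `g` in the ball is separated from the closed hull by
`φ` at level `u`. Since `1 < q ≤ 2`, `φ` is the pairing with some `h ∈ L^p`
(`exists_eq_integral_mul`). If `‖h‖ = ‖h‖_{U(d)} > 0`, testing `φ` on the dual function of `h / ‖h‖`
gives `‖h‖ < u < ⟨g ; h⟩ ≤ ‖h‖`. If `‖h‖ = 0`, then `⟨g ; h⟩ = 0` while `u > 0`. For `d = 1` the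
dual of `L^∞` is too large, but the ball consists of the constants of modulus at most 1, which are
dual functions themselves.

When `Z` is not second countable, addition need not be measurable for the product of the Borel
σ-algebras. The Fubini arguments are therefore run on the Baire σ-algebra, where addition is
measurable, and every `L^p` class with `p < ∞` has a Baire representative. -/

theorem measurePreserving_of_surjective {K L : Type*} [AddCommGroup K] [MeasurableSpace K]
    [MeasurableAdd K] [AddCommGroup L] [MeasurableSpace L] [MeasurableAdd₂ L] [MeasurableNeg L]
    (κ : Measure K) (ν : Measure L) [IsProbabilityMeasure κ] [IsProbabilityMeasure ν]
    [κ.IsAddLeftInvariant] [ν.IsAddLeftInvariant] (φ : K →+ L) (hφ : Measurable φ)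
    (hs : Function.Surjective φ) : MeasurePreserving φ κ ν := by
  refine ⟨hφ, ?_⟩
  have : (κ.map φ).IsAddLeftInvariant := isAddLeftInvariant_map (φ : AddHom K L) hφ hs
  have : IsProbabilityMeasure (κ.map φ) := Measure.isProbabilityMeasure_map hφ.aemeasurable
  ext t -
  -- Translation-invariant measures satisfy `μ s * ν t = ν s * μ t`; with `s = univ` and total
  -- masses 1 they coincide, without any topology.
  have h := measure_add_measure_eq (κ.map φ) ν Set.univ t (by simp) (by simp)
  simpa using h.symm

/-! ### Combinatorics of the cube and two changes of variables -/

section dot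

variable {Z : Type*} [AddCommGroup Z] {d : ℕ}

theorem dot_add (ε : Fin d → Fin 2) (s t : Fin d → Z) : dot ε (s + t) = dot ε s + dot ε t := by
  simp [dot, Finset.sum_add_distrib]

@[simp] theorem zero_dot (t : Fin d → Z) : dot 0 t = 0 := by simp [dot]

@[simp] theorem dot_zero (ε : Fin d → Fin 2) : dot ε (0 : Fin d → Z) = 0 := by simp [dot]

/-- The homomorphism `t ↦ ε · t`. -/
def dotHom (ε : Fin d → Fin 2) : (Fin d → Z) →+ Z where
  toFun := dot ε
  map_zero' := dot_zero ε
  map_add' := dot_add ε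

theorem dot_insertNth {n : ℕ} (i : Fin (n + 1)) (a : Fin 2) (ε : Fin n → Fin 2) (s : Z)
    (t : Fin n → Z) :
    dot (i.insertNth (α := fun _ => Fin 2) a ε) (i.insertNth (α := fun _ => Z) s t) =
      (a : ℕ) • s + dot ε t := by
  simp [dot, Fin.sum_univ_succAbove _ i]

theorem dot_surjective {ε : Fin d → Fin 2} (h : ε ≠ 0) :
    Function.Surjective (dot ε : (Fin d → Z) → Z) := by
  intro z
  obtain ⟨i, hi⟩ := Function.ne_iff.1 h
  have hi : ε i = 1 := by have := hi; simp at this; omega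
  refine ⟨Pi.single i z, ?_⟩
  rw [dot, Finset.sum_eq_single i] <;> simp +contextual [hi]

theorem measurable_dot [MeasurableSpace Z] [MeasurableAdd₂ Z] (ε : Fin d → Fin 2) :
    Measurable (dot ε : (Fin d → Z) → Z) := by
  refine Finset.measurable_fun_sum _ fun i _ => ?_
  have : ∀ k : ℕ, Measurable fun t : Fin d → Z => k • t i := by
    intro k
    induction k with
    | zero => simp
    | succ k ih => simp only [succ_nsmul]; exact ih.add (measurable_pi_apply i)
  exact this _

theorem prod_insertNth {M : Type*} [CommMonoid M] {n : ℕ} (i : Fin (n + 1))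
    (u : (Fin (n + 1) → Fin 2) → M) :
    ∏ ε, u ε = (∏ ε, u (i.insertNth (α := fun _ => Fin 2) 0 ε)) *
      ∏ ε, u (i.insertNth (α := fun _ => Fin 2) 1 ε) := by
  rw [← (Fin.insertNthEquiv (fun _ => Fin 2) i).prod_comp, Fintype.prod_prod_type,
    Fin.prod_univ_two]
  rfl

/-- The change of variables `(t, x, y) ↦ (x, t')`, where `t'` is `t` with `y - x` inserted as
coordinate `i`. -/
def splitHom {n : ℕ} (i : Fin (n + 1)) :
    ((Fin n → Z) × Z × Z) →+ Z × (Fin (n + 1) → Z) where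
  toFun w := (w.2.1, i.insertNth (α := fun _ => Z) (w.2.2 - w.2.1) w.1)
  map_zero' := by
    refine Prod.ext rfl ?_
    simp
  map_add' v w := by
    refine Prod.ext rfl ?_
    change _ = (i.insertNth (α := fun _ => Z) (v.2.2 - v.2.1) v.1 : Fin (n + 1) → Z) +
      i.insertNth (α := fun _ => Z) (w.2.2 - w.2.1) w.1
    rw [← Fin.insertNth_add]
    rw [← add_sub_add_comm]
    rfl

/-- The change of variables `(s, x, t) ↦ (x, t')`, where `t'` is `t` with `s` inserted as
coordinate `i`. -/
def shearHom {n : ℕ} (i : Fin (n + 1)) :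
    (Z × Z × (Fin n → Z)) →+ Z × (Fin (n + 1) → Z) where
  toFun w := (w.2.1, i.insertNth (α := fun _ => Z) w.1 w.2.2)
  map_zero' := by
    refine Prod.ext rfl ?_
    simp
  map_add' v w := by
    refine Prod.ext rfl ?_
    change _ = (i.insertNth (α := fun _ => Z) v.1 v.2.2 : Fin (n + 1) → Z) +
      i.insertNth (α := fun _ => Z) w.1 w.2.2
    rw [← Fin.insertNth_add]
    rfl

/-- The cube splits into two opposite faces, based at `x` and at `y = x + t_i`. For fixed `t` the
two base points are independent, which is what Cauchy-Schwarz needs. -/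
theorem prod_splitHom {M : Type*} [CommMonoid M] {n : ℕ} (i : Fin (n + 1))
    (u : (Fin (n + 1) → Fin 2) → Z → M) (w : (Fin n → Z) × Z × Z) :
    ∏ ε, u ε ((splitHom i w).1 + dot ε (splitHom i w).2) =
      (∏ ε, u (i.insertNth (α := fun _ => Fin 2) 0 ε) (w.2.1 + dot ε w.1)) *
      ∏ ε, u (i.insertNth (α := fun _ => Fin 2) 1 ε) (w.2.2 + dot ε w.1) := by
  rw [prod_insertNth i]
  simp [splitHom, dot_insertNth]
  simp [← add_assoc]

/-- Here opposite vertices are paired along direction `i`: for fixed `s` there remains a cube of one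
dimension less, carrying the products `u₀ · u₁(s + ·)`. This drives the induction in
`lintegral_prod_le`. -/
theorem prod_shearHom {M : Type*} [CommMonoid M] {n : ℕ} (i : Fin (n + 1))
    (u : (Fin (n + 1) → Fin 2) → Z → M) (w : Z × Z × (Fin n → Z)) :
    ∏ ε, u ε ((shearHom i w).1 + dot ε (shearHom i w).2) =
      ∏ ε, (u (i.insertNth (α := fun _ => Fin 2) 0 ε) (w.2.1 + dot ε w.2.2) *
        u (i.insertNth (α := fun _ => Fin 2) 1 ε) (w.1 + (w.2.1 + dot ε w.2.2))) := by
  rw [prod_insertNth i, Finset.prod_mul_distrib]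
  simp [shearHom, dot_insertNth]
  simp [add_left_comm]

theorem splitHom_surjective {n : ℕ} (i : Fin (n + 1)) :
    Function.Surjective (splitHom i : ((Fin n → Z) × Z × Z) →+ Z × (Fin (n + 1) → Z)) := by
  rintro ⟨x, t⟩
  exact ⟨(i.removeNth t, x, x + t i), by simp [splitHom]⟩

theorem shearHom_surjective {n : ℕ} (i : Fin (n + 1)) :
    Function.Surjective (shearHom i : (Z × Z × (Fin n → Z)) →+ Z × (Fin (n + 1) → Z)) := by
  rintro ⟨x, t⟩
  exact ⟨(t i, x, i.removeNth t), by simp [shearHom]⟩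

theorem measurable_prod_comp_dot [MeasurableSpace Z] [MeasurableAdd₂ Z] {R : Type*}
    [CommMonoid R] [MeasurableSpace R] [MeasurableMul₂ R] (s : Finset (Fin d → Fin 2))
    {u : (Fin d → Fin 2) → Z → R}
    (hu : ∀ ε, Measurable (u ε)) :
    Measurable fun y : Z × (Fin d → Z) => ∏ ε ∈ s, u ε (y.1 + dot ε y.2) :=
  Finset.measurable_fun_prod _ fun ε _ =>
    (hu ε).comp (measurable_fst.add ((measurable_dot ε).comp measurable_snd))

end dot

instance measurableAdd₂_prod {X Y : Type*} [MeasurableSpace X] [MeasurableSpace Y] [Add X] [Add Y]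
    [MeasurableAdd₂ X] [MeasurableAdd₂ Y] : MeasurableAdd₂ (X × Y) :=
  ⟨((measurable_fst.comp measurable_fst).add (measurable_fst.comp measurable_snd)).prodMk
    ((measurable_snd.comp measurable_fst).add (measurable_snd.comp measurable_snd))⟩

instance measurableNeg_prod {X Y : Type*} [MeasurableSpace X] [MeasurableSpace Y] [Neg X] [Neg Y]
    [MeasurableNeg X] [MeasurableNeg Y] : MeasurableNeg (X × Y) :=
  ⟨measurable_fst.neg.prodMk measurable_snd.neg⟩

/-! ### The `L^{2^n}` bound for the multilinear form -/

section form

variable {Y : Type*} [AddCommGroup Y] [MeasurableSpace Y] [MeasurableAdd₂ Y] [MeasurableNeg Y]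
  (μ : Measure Y) [IsProbabilityMeasure μ] [μ.IsAddLeftInvariant] {n : ℕ}

theorem measurePreserving_splitHom (i : Fin (n + 1)) :
    MeasurePreserving (splitHom i : ((Fin n → Y) × Y × Y) →+ Y × (Fin (n + 1) → Y))
      ((Measure.pi fun _ => μ).prod (μ.prod μ)) (μ.prod (Measure.pi fun _ => μ)) := by
  refine measurePreserving_of_surjective _ _ _ ?_ (splitHom_surjective i)
  refine Measurable.prodMk (by fun_prop) ?_
  refine measurable_pi_iff.2 fun j => ?_
  refine i.succAboveCases ?_ (fun k => ?_) j
  · simp only [Fin.insertNth_apply_same]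
    simp only [sub_eq_add_neg]
    fun_prop
  · simp only [Fin.insertNth_apply_succAbove]
    fun_prop

theorem measurePreserving_shearHom (i : Fin (n + 1)) :
    MeasurePreserving (shearHom i : (Y × Y × (Fin n → Y)) →+ Y × (Fin (n + 1) → Y))
      (μ.prod (μ.prod (Measure.pi fun _ => μ))) (μ.prod (Measure.pi fun _ => μ)) := by
  refine measurePreserving_of_surjective _ _ _ ?_ (shearHom_surjective i)
  refine Measurable.prodMk (by fun_prop) ?_
  refine measurable_pi_iff.2 fun j => ?_
  refine i.succAboveCases ?_ (fun k => ?_) j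
  · simp only [Fin.insertNth_apply_same]
    fun_prop
  · simp only [Fin.insertNth_apply_succAbove]
    fun_prop

theorem lintegral_mul_comp_add_rpow_le {u v : Y → ℝ≥0∞} (hu : Measurable u) (hv : Measurable v)
    (s : Y) (n : ℕ) :
    (∫⁻ x, (u x * v (s + x)) ^ (2 ^ n : ℝ) ∂μ) ^ (1 / 2 ^ n : ℝ) ≤
      (∫⁻ x, u x ^ (2 ^ (n + 1) : ℝ) ∂μ) ^ (1 / 2 ^ (n + 1) : ℝ) *
        (∫⁻ x, v x ^ (2 ^ (n + 1) : ℝ) ∂μ) ^ (1 / 2 ^ (n + 1) : ℝ) := by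
  have h := ENNReal.lintegral_mul_le_Lp_mul_Lq μ Real.HolderConjugate.two_two
    (hu.pow_const (2 ^ n : ℝ)).aemeasurable
    ((hv.comp (measurable_const_add s)).pow_const (2 ^ n : ℝ)).aemeasurable
  simp only [Pi.mul_apply, ← ENNReal.rpow_mul, ← pow_succ, Function.comp_apply] at h
  rw [lintegral_add_left_eq_self (fun x => v x ^ (2 ^ (n + 1) : ℝ)) s] at h
  simp only [ENNReal.mul_rpow_of_nonneg _ _ (show (0 : ℝ) ≤ 2 ^ n by positivity)]
  refine (ENNReal.rpow_le_rpow h (by positivity)).trans_eq ?_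
  rw [ENNReal.mul_rpow_of_nonneg _ _ (by positivity), ← ENNReal.rpow_mul, ← ENNReal.rpow_mul]
  congr 2 <;> · field_simp; ring

/-- A bound for the multilinear form behind the Gowers norm of level `n + 1` by norms of
`L^(2^n)`. -/
theorem lintegral_prod_le (u : (Fin (n + 1) → Fin 2) → Y → ℝ≥0∞)
    (hu : ∀ ε, Measurable (u ε)) :
    ∫⁻ y, ∏ ε, u ε (y.1 + dot ε y.2) ∂(μ.prod (Measure.pi fun _ : Fin (n + 1) => μ)) ≤
      ∏ ε, (∫⁻ x, u ε x ^ (2 ^ n : ℝ) ∂μ) ^ (1 / 2 ^ n : ℝ) := by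
  induction n with
  | zero =>
    -- In dimension one, `x` and `x + t` are independent, so the form is a product of two integrals.
    have hm := measurable_prod_comp_dot Finset.univ hu
    rw [← (measurePreserving_splitHom μ 0).lintegral_comp hm,
      lintegral_prod _ (by
        exact (hm.comp (measurePreserving_splitHom μ 0).measurable).aemeasurable)]
    simp only [prod_splitHom]
    rw [prod_insertNth 0]
    simp only [Finset.univ_unique, Finset.prod_singleton, pow_zero, ENNReal.rpow_one, div_one]
    have h0 : ∀ (ε : Fin 0 → Fin 2) (t : Fin 0 → Y), dot ε t = 0 := fun ε t => by simp [dot]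
    simp only [h0, add_zero]
    rw [lintegral_prod_mul (hu _).aemeasurable (hu _).aemeasurable, lintegral_const, measure_univ,
      mul_one]
  | succ n ih =>
    have hm := measurable_prod_comp_dot Finset.univ hu
    rw [← (measurePreserving_shearHom μ 0).lintegral_comp hm,
      lintegral_prod _ (by
        exact (hm.comp (measurePreserving_shearHom μ 0).measurable).aemeasurable)]
    simp only [prod_shearHom]
    -- For fixed `s`, the induction hypothesis followed by Cauchy-Schwarz at each vertex gives a
    -- bound that no longer depends on `s`.
    refine (lintegral_mono fun s => (ih (fun ε x =>
      u ((0 : Fin (n + 2)).insertNth (α := fun _ => Fin 2) 0 ε) x *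
        u ((0 : Fin (n + 2)).insertNth (α := fun _ => Fin 2) 1 ε) (s + x))
      fun ε => (hu _).mul ((hu _).comp (measurable_const_add s))).trans
      (Finset.prod_le_prod' fun ε _ =>
        lintegral_mul_comp_add_rpow_le μ (hu _) (hu _) s n)).trans_eq ?_
    rw [lintegral_const, measure_univ, mul_one, Finset.prod_mul_distrib,
      prod_insertNth (0 : Fin (n + 2)) (fun ε =>
        (∫⁻ x, u ε x ^ (2 ^ (n + 1) : ℝ) ∂μ) ^ (1 / 2 ^ (n + 1) : ℝ))]

theorem integrable_prod {F : (Fin (n + 1) → Fin 2) → Y → ℝ} (hm : ∀ ε, Measurable (F ε))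
    (hF : ∀ ε, MemLp (F ε) (2 ^ n) μ) :
    Integrable (fun y : Y × (Fin (n + 1) → Y) => ∏ ε, F ε (y.1 + dot ε y.2))
      (μ.prod (Measure.pi fun _ => μ)) := by
  refine ⟨(measurable_prod_comp_dot _ hm).aestronglyMeasurable, ?_⟩
  rw [hasFiniteIntegral_iff_enorm]
  have hprod : ∀ y : Y × (Fin (n + 1) → Y), ‖∏ ε, F ε (y.1 + dot ε y.2)‖ₑ =
      ∏ ε, ‖F ε (y.1 + dot ε y.2)‖ₑ := fun y => by
    simp [enorm_eq_nnnorm, nnnorm_prod]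
  simp only [hprod]
  refine (lintegral_prod_le μ (fun ε x => ‖F ε x‖ₑ) fun ε => (hm ε).enorm).trans_lt ?_
  refine ENNReal.prod_lt_top fun ε _ => ?_
  have h := (hF ε).2
  rw [eLpNorm_eq_lintegral_rpow_enorm_toReal (by simp) (by simp)] at h
  simpa using h

end form

/-! ### Converse Hölder inequality and the dual of `L^q` for `1 < q ≤ 2` -/

section duality

variable {α : Type*} [MeasurableSpace α] {μ : Measure α}

/-- Testing with `k = min(u, n)^(q-1)` gives `I ≤ C * I^(1/p)` for `I = ∫ min(u, n)^q`. Truncation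
makes `I` finite, so one may divide; Fatou's lemma then removes the truncation. -/
theorem lintegral_rpow_le_of_forall_bounded [IsFiniteMeasure μ] {p q : ℝ}
    (hpq : p.HolderConjugate q)
    {u : α → ℝ≥0∞} (hu : Measurable u) {C : ℝ≥0∞}
    (h : ∀ (k : α → ℝ≥0∞) (c : ℝ≥0∞), Measurable k → c ≠ ∞ → (∀ x, k x ≤ c) →
      ∫⁻ x, k x * u x ∂μ ≤ C * (∫⁻ x, k x ^ p ∂μ) ^ (1 / p)) :
    ∫⁻ x, u x ^ q ∂μ ≤ C ^ q := by
  have hp := hpq.pos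
  have hq := hpq.symm.pos
  have hq1 := hpq.symm.sub_one_pos
  have hM : ∀ n : ℕ, Measurable fun x => min (u x) (n : ℝ≥0∞) := fun n => hu.min measurable_const
  have key : ∀ n : ℕ, ∫⁻ x, min (u x) (n : ℝ≥0∞) ^ q ∂μ ≤ C ^ q := by
    intro n
    set I := ∫⁻ x, min (u x) (n : ℝ≥0∞) ^ q ∂μ with hI
    have hfin : I ≠ ∞ := by
      have : I ≤ ∫⁻ _, (n : ℝ≥0∞) ^ q ∂μ :=
        lintegral_mono fun x => ENNReal.rpow_le_rpow (min_le_right _ _) hq.le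
      refine (this.trans_lt ?_).ne
      rw [lintegral_const]
      exact ENNReal.mul_lt_top (ENNReal.rpow_lt_top_of_nonneg hq.le (by simp)) (measure_lt_top _ _)
    rcases eq_or_ne I 0 with h0 | h0
    · simp [h0]
    have h1 : I ≤ C * I ^ (1 / p) := by
      refine le_trans ?_ ((h (fun x => min (u x) (n : ℝ≥0∞) ^ (q - 1)) ((n : ℝ≥0∞) ^ (q - 1))
        ((hM n).pow_const _) (ENNReal.rpow_lt_top_of_nonneg hq1.le (by simp)).ne fun x =>
          ENNReal.rpow_le_rpow (min_le_right _ _) hq1.le).trans_eq ?_)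
      · refine lintegral_mono fun x => ?_
        calc min (u x) (n : ℝ≥0∞) ^ q = min (u x) (n : ℝ≥0∞) ^ ((q - 1) + 1) := by simp
          _ = min (u x) (n : ℝ≥0∞) ^ (q - 1) * min (u x) (n : ℝ≥0∞) := by
            rw [ENNReal.rpow_add_of_nonneg _ _ hq1.le zero_le_one, ENNReal.rpow_one]
          _ ≤ _ := by gcongr; exact min_le_left _ _
      · simp only [← ENNReal.rpow_mul]
        rw [hI, show (q - 1) * p = q by rw [hpq.symm.sub_one_mul_conj]]
    have h2 : I ^ (1 / q) ≤ C := by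
      have h3 : I = I ^ (1 / q) * I ^ (1 / p) := by
        rw [← ENNReal.rpow_add _ _ h0 hfin]
        have := hpq.inv_add_inv_eq_one
        rw [show 1 / q + 1 / p = 1 by simpa [add_comm] using this, ENNReal.rpow_one]
      nth_rw 1 [h3] at h1
      exact (ENNReal.mul_le_mul_iff_left
        (ENNReal.rpow_pos (pos_iff_ne_zero.2 h0) hfin).ne'
        (ENNReal.rpow_lt_top_of_nonneg (by positivity) hfin).ne).1 h1
    calc I = (I ^ (1 / q)) ^ q := by rw [← ENNReal.rpow_mul]; simp [hq.ne']
      _ ≤ C ^ q := ENNReal.rpow_le_rpow h2 hq.le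
  have hlim : ∀ x, Filter.Tendsto (fun n : ℕ => min (u x) (n : ℝ≥0∞) ^ q) Filter.atTop
      (nhds (u x ^ q)) := fun x => by
    have := (tendsto_const_nhds (x := u x)).min ENNReal.tendsto_nat_nhds_top
    rw [min_eq_left le_top] at this
    exact (ENNReal.continuous_rpow_const.tendsto _).comp this
  calc ∫⁻ x, u x ^ q ∂μ
      = ∫⁻ x, Filter.liminf (fun n : ℕ => min (u x) (n : ℝ≥0∞) ^ q) Filter.atTop ∂μ := by
        simp only [(hlim _).liminf_eq]
    _ ≤ Filter.liminf (fun n : ℕ => ∫⁻ x, min (u x) (n : ℝ≥0∞) ^ q ∂μ) Filter.atTop :=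
        lintegral_liminf_le fun n => (hM n).pow_const _
    _ ≤ C ^ q := by
      refine (Filter.liminf_le_liminf (Filter.Eventually.of_forall key)).trans_eq ?_
      simp

/-- The inclusion of `L^p` into `L^q` for `q ≤ p` on a probability space. -/
def lpInclusion (μ : Measure α) [IsProbabilityMeasure μ] {p q : ℝ≥0∞} [Fact (1 ≤ p)]
    [Fact (1 ≤ q)] (h : q ≤ p) : Lp ℝ p μ →L[ℝ] Lp ℝ q μ :=
  LinearMap.mkContinuous
    { toFun := fun f => ((Lp.memLp f).mono_exponent h).toLp f
      map_add' := fun f g => by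
        rw [← MemLp.toLp_add]
        exact MemLp.toLp_congr _ _ (Lp.coeFn_add f g)
      map_smul' := fun c f => by
        rw [RingHom.id_apply, ← MemLp.toLp_const_smul]
        exact MemLp.toLp_congr _ _ (Lp.coeFn_smul c f) } 1 fun f => by
    rw [one_mul]
    simp only [LinearMap.coe_mk, AddHom.coe_mk]
    rw [Lp.norm_toLp, Lp.norm_def]
    exact ENNReal.toReal_mono (Lp.eLpNorm_ne_top f)
      (eLpNorm_le_eLpNorm_of_exponent_le h (Lp.aestronglyMeasurable f))

theorem coeFn_lpInclusion [IsProbabilityMeasure μ] {p q : ℝ≥0∞} [Fact (1 ≤ p)]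
    [Fact (1 ≤ q)] (h : q ≤ p) (f : Lp ℝ p μ) : lpInclusion μ h f =ᵐ[μ] f :=
  MemLp.coeFn_toLp ((Lp.memLp f).mono_exponent h)

theorem memLp_of_forall_bounded [IsFiniteMeasure μ] {p q : ℝ≥0∞} (hpt : p ≠ ∞) (hqt : q ≠ ∞)
    [p.HolderConjugate q] {h : α → ℝ} (hm : Measurable h) {C : ℝ≥0∞} (hC : C ≠ ∞)
    (H : ∀ (k : α → ℝ≥0∞) (c : ℝ≥0∞), Measurable k → c ≠ ∞ → (∀ x, k x ≤ c) →
      ∫⁻ x, k x * ‖h x‖ₑ ∂μ ≤ C * (∫⁻ x, k x ^ q.toReal ∂μ) ^ (1 / q.toReal)) :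
    MemLp h p μ := by
  have hpq : p.toReal.HolderConjugate q.toReal :=
    ENNReal.HolderConjugate.toReal_of_ne_top hpt hqt
  refine ⟨hm.aestronglyMeasurable, ?_⟩
  rw [eLpNorm_lt_top_iff_lintegral_rpow_enorm_lt_top (ENNReal.HolderConjugate.ne_zero p q) hpt]
  exact (lintegral_rpow_le_of_forall_bounded hpq.symm hm.enorm H).trans_lt
    (ENNReal.rpow_lt_top_of_nonneg hpq.pos.le hC)

/-- Continuous linear functionals on `L^q`, `1 < q ≤ 2`, are given by functions in `L^p`. -/
theorem exists_eq_integral_mul (μ : Measure α) [IsProbabilityMeasure μ] {p q : ℝ≥0∞}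
    [Fact (1 ≤ p)] [Fact (1 ≤ q)] [p.HolderConjugate q] (hpt : p ≠ ∞) (hq : q ≤ 2)
    (φ : Lp ℝ q μ →L[ℝ] ℝ) : ∃ h : Lp ℝ p μ, ∀ g : Lp ℝ q μ, φ g = ∫ x, h x * g x ∂μ := by
  have hqt : q ≠ ∞ := (hq.trans_lt (by simp)).ne
  -- As `q ≤ 2`, `φ` restricts to `L²`, where the Riesz representation theorem supplies `h`; it
  -- remains to show `h ∈ L^p` and to extend the formula to `L^q`.
  set h := (InnerProductSpace.toDual ℝ (Lp ℝ 2 μ)).symm (φ ∘L lpInclusion μ hq) with hh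
  have hφ : ∀ f : Lp ℝ 2 μ, φ (lpInclusion μ hq f) = ∫ x, h x * f x ∂μ := by
    intro f
    have : inner ℝ h f = (φ ∘L lpInclusion μ hq) f := by
      rw [hh, InnerProductSpace.toDual_symm_apply]
    rw [L2.inner_def] at this
    rw [← ContinuousLinearMap.comp_apply, ← this]
    refine integral_congr_ae (.of_forall fun x => ?_)
    simp [mul_comm]
  have hm : Measurable h := (Lp.stronglyMeasurable h).measurable
  have hmem : MemLp h p μ := by
    refine memLp_of_forall_bounded hpt hqt hm (C := ‖φ‖ₑ) (by simp) fun k c hk hc hkc => ?_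
    have hkt : ∀ x, k x ≠ ∞ := fun x => ne_top_of_le_ne_top hc (hkc x)
    -- The test function `k` with the sign of `h`, so that `h * g = |h| * k`.
    set g : α → ℝ := fun x => if 0 ≤ h x then (k x).toReal else -(k x).toReal with hg
    have hgm : Measurable g :=
      Measurable.ite (measurableSet_le measurable_const hm) hk.ennreal_toReal hk.ennreal_toReal.neg
    have hgk : ∀ x, ‖g x‖ₑ ≤ k x := fun x => by
      have : ‖g x‖ₑ = ‖(k x).toReal‖ₑ := by
        simp only [hg]
        split_ifs <;> simp
      rw [this, Real.enorm_eq_ofReal ENNReal.toReal_nonneg, ENNReal.ofReal_toReal (hkt x)]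
    have hgL : MemLp g 2 μ := by
      refine MemLp.of_bound hgm.aestronglyMeasurable c.toReal (.of_forall fun x => ?_)
      rw [← toReal_enorm]
      exact ENNReal.toReal_mono hc ((hgk x).trans (hkc x))
    have hhg : ∀ x, h x * g x = |h x| * (k x).toReal := fun x => by
      simp only [hg]
      split_ifs with h0
      · rw [abs_of_nonneg h0]
      · rw [abs_of_neg (not_le.1 h0)]; ring
    have hφg := hφ (hgL.toLp g)
    have h1 : ∫ x, h x * hgL.toLp g x ∂μ = ∫ x, |h x| * (k x).toReal ∂μ := by
      refine integral_congr_ae ?_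
      filter_upwards [hgL.coeFn_toLp] with x hx
      rw [hx, hhg]
    rw [h1] at hφg
    calc ∫⁻ x, k x * ‖h x‖ₑ ∂μ = ∫⁻ x, ENNReal.ofReal (|h x| * (k x).toReal) ∂μ := by
          refine lintegral_congr fun x => ?_
          rw [ENNReal.ofReal_mul (abs_nonneg _), ENNReal.ofReal_toReal (hkt x), mul_comm,
            Real.enorm_eq_ofReal_abs]
      _ = ENNReal.ofReal (φ (lpInclusion μ hq (hgL.toLp g))) := by
          rw [hφg, ofReal_integral_eq_lintegral_ofReal]
          · simp only [← hhg]
            exact (Lp.memLp h).integrable_mul hgL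
          · exact .of_forall fun x => by positivity
      _ ≤ ‖φ (lpInclusion μ hq (hgL.toLp g))‖ₑ := by
          rw [Real.enorm_eq_ofReal_abs]
          exact ENNReal.ofReal_le_ofReal (le_abs_self _)
      _ ≤ ‖φ‖ₑ * ‖lpInclusion μ hq (hgL.toLp g)‖ₑ := φ.le_opENorm _
      _ ≤ _ := by
          gcongr
          rw [Lp.enorm_def, eLpNorm_congr_ae ((coeFn_lpInclusion hq _).trans hgL.coeFn_toLp),
            eLpNorm_eq_lintegral_rpow_enorm_toReal (ENNReal.HolderConjugate.ne_zero q p) hqt]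
          gcongr with x
          exact hgk x
  refine ⟨hmem.toLp h, fun g => ?_⟩
  have hpair : ∀ g : Lp ℝ q μ, (ContinuousLinearMap.mul ℝ ℝ).lpPairing μ p q (hmem.toLp h) g =
      ∫ x, hmem.toLp h x * g x ∂μ := fun g => by
    rw [ContinuousLinearMap.lpPairing_eq_integral]; rfl
  rw [← hpair]
  -- Both functionals are continuous, and they agree on simple functions, which lie in `L²` and are
  -- dense in `L^q`.
  refine congr_fun ((Lp.simpleFunc.denseRange hqt).equalizer φ.continuous
    (ContinuousLinearMap.continuous _) (funext fun s => ?_)) g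
  have hs : MemLp (Lp.simpleFunc.toSimpleFunc s) 2 μ := SimpleFunc.memLp_of_isFiniteMeasure _ _ _
  have hse : (s : Lp ℝ q μ) = lpInclusion μ hq (hs.toLp _) := by
    refine Lp.ext ?_
    exact (Lp.simpleFunc.toSimpleFunc_eq_toFun s).symm.trans
      ((coeFn_lpInclusion hq _).trans hs.coeFn_toLp).symm
  simp only [Function.comp_apply]
  rw [hpair, hse, hφ]
  refine integral_congr_ae ?_
  filter_upwards [hmem.coeFn_toLp, coeFn_lpInclusion hq (hs.toLp _)] with x hx hx'
  rw [hx, hx']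

end duality

theorem expP_succ (n : ℕ) : expP (n + 1) = 2 ^ n := by simp [expP]

theorem expP_ne_top (d : ℕ) : expP d ≠ ∞ := by simp [expP]

theorem expQ_one : expQ 1 = ∞ := by simp [expQ]

instance holderConjugate_expP_expQ (d : ℕ) : (expP d).HolderConjugate (expQ d) := by
  refine ⟨?_⟩
  have h1 : (1 : ℝ≥0∞) ≤ 2 ^ (d - 1) := one_le_pow_of_one_le' (by norm_num) _
  have h0 : (2 : ℝ≥0∞) ^ (d - 1) ≠ 0 := by positivity
  have ht : (2 : ℝ≥0∞) ^ (d - 1) ≠ ∞ := by simp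
  rw [expP, expQ, ENNReal.inv_div (Or.inr ht) (Or.inr h0), div_eq_mul_inv, inv_one]
  nth_rw 1 [← one_mul ((2 : ℝ≥0∞) ^ (d - 1))⁻¹]
  rw [← add_mul, add_tsub_cancel_of_le h1, ENNReal.mul_inv_cancel h0 ht]

instance holderConjugate_expQ_expP (d : ℕ) : (expQ d).HolderConjugate (expP d) :=
  (holderConjugate_expP_expQ d).symm

theorem expQ_le_two (n : ℕ) : expQ (n + 2) ≤ 2 := by
  have h1 : (2 : ℝ≥0∞) ≤ 2 ^ (n + 1) := by
    rw [pow_succ]; exact le_mul_of_one_le_left' (one_le_pow_of_one_le' (by norm_num) _)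
  have ht : (2 : ℝ≥0∞) ^ (n + 1) ≠ ∞ := by simp
  rw [expQ, show n + 2 - 1 = n + 1 from rfl]
  refine ENNReal.div_le_of_le_mul ?_
  rw [ENNReal.mul_sub (fun _ _ => by simp), mul_one, two_mul]
  refine (ENNReal.le_sub_of_add_le_left (by simp) ?_)
  gcongr

theorem prod_ite_eq_zero {M : Type*} [CommMonoid M] {d : ℕ} (a b : (Fin d → Fin 2) → M) :
    ∏ ε, (if ε = 0 then a ε else b ε) = a 0 * ∏ ε with ε ≠ 0, b ε := by
  rw [Finset.prod_ite, Finset.filter_eq']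
  simp

/-! ### Positivity, Cauchy-Schwarz-Gowers and integrability of dual functions -/

section form

variable {Y : Type*} [AddCommGroup Y] [MeasurableSpace Y] [MeasurableAdd₂ Y] [MeasurableNeg Y]
  (μ : Measure Y) [IsProbabilityMeasure μ] [μ.IsAddLeftInvariant] {n : ℕ}

/-- The multilinear form behind the Gowers norm. -/
def gowersForm {d : ℕ} (F : (Fin d → Fin 2) → Y → ℝ) : ℝ :=
  ∫ y, ∏ ε, F ε (y.1 + dot ε y.2) ∂(μ.prod (Measure.pi fun _ : Fin d => μ))

/-- The average over `x` of `∏ F_ε (x + ε · t)`. -/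
def cubeAvg {d : ℕ} (F : (Fin d → Fin 2) → Y → ℝ) (t : Fin d → Y) : ℝ :=
  ∫ x, ∏ ε, F ε (x + dot ε t) ∂μ

/-- The dual function with respect to the measure `μ`. -/
def dualAvg (d : ℕ) (f : Y → ℝ) (x : Y) : ℝ :=
  ∫ t, ∏ ε : Fin d → Fin 2 with ε ≠ 0, f (x + dot ε t) ∂(Measure.pi fun _ : Fin d => μ)

/-- Fubini after `splitHom`: the averages over the two opposite faces decouple. The positivity and
Cauchy-Schwarz statements below rest on this factorization. -/
theorem gowersForm_eq_integral (i : Fin (n + 1)) {F : (Fin (n + 1) → Fin 2) → Y → ℝ}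
    (hm : ∀ ε, Measurable (F ε)) (hF : ∀ ε, MemLp (F ε) (2 ^ n) μ) :
    Integrable (fun t : Fin n → Y =>
        cubeAvg μ (fun ε => F (i.insertNth (α := fun _ => Fin 2) 0 ε)) t *
        cubeAvg μ (fun ε => F (i.insertNth (α := fun _ => Fin 2) 1 ε)) t)
        (Measure.pi fun _ => μ) ∧
    gowersForm μ F = ∫ t : Fin n → Y,
        cubeAvg μ (fun ε => F (i.insertNth (α := fun _ => Fin 2) 0 ε)) t *
        cubeAvg μ (fun ε => F (i.insertNth (α := fun _ => Fin 2) 1 ε)) t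
        ∂(Measure.pi fun _ => μ) := by
  have hmp := measurePreserving_splitHom μ i
  have hI := integrable_prod μ hm hF
  have hI' := (hmp.integrable_comp hI.aestronglyMeasurable).2 hI
  have h1 : gowersForm μ F = ∫ w, ∏ ε, F ε ((splitHom i w).1 + dot ε (splitHom i w).2)
      ∂((Measure.pi fun _ : Fin n => μ).prod (μ.prod μ)) := by
    rw [gowersForm, ← hmp.map_eq, integral_map hmp.aemeasurable]
    rw [hmp.map_eq]
    exact hI.aestronglyMeasurable
  have h2 : ∀ t : Fin n → Y, ∫ z : Y × Y, ∏ ε,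
      F ε ((splitHom i (t, z)).1 + dot ε (splitHom i (t, z)).2) ∂(μ.prod μ) =
      cubeAvg μ (fun ε => F (i.insertNth (α := fun _ => Fin 2) 0 ε)) t *
        cubeAvg μ (fun ε => F (i.insertNth (α := fun _ => Fin 2) 1 ε)) t := fun t => by
    simp only [prod_splitHom]
    exact integral_prod_mul
      (fun x => ∏ ε, F (i.insertNth (α := fun _ => Fin 2) 0 ε) (x + dot ε t))
      (fun x => ∏ ε, F (i.insertNth (α := fun _ => Fin 2) 1 ε) (x + dot ε t))
  simp only [← h2]
  refine ⟨hI'.integral_prod_left, ?_⟩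
  rw [h1]
  exact integral_prod _ hI'

/-- Freezing coordinate `i` puts the same functions on both faces, so the integrand is a square. -/
theorem gowersForm_update_nonneg (i : Fin (n + 1)) (b : Fin 2)
    {F : (Fin (n + 1) → Fin 2) → Y → ℝ}
    (hm : ∀ ε, Measurable (F ε)) (hF : ∀ ε, MemLp (F ε) (2 ^ n) μ) :
    0 ≤ gowersForm μ (fun ε => F (Function.update ε i b)) := by
  rw [(gowersForm_eq_integral μ i (fun ε => hm _) (fun ε => hF _)).2]
  simp only [Fin.update_insertNth]
  exact integral_nonneg fun t => mul_self_nonneg _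

/-- Cauchy-Schwarz in the additive form `2|ab| ≤ a² + b²`, which avoids square roots and is enough
for bounds by 1. -/
theorem two_mul_abs_gowersForm_le (i : Fin (n + 1)) {F : (Fin (n + 1) → Fin 2) → Y → ℝ}
    (hm : ∀ ε, Measurable (F ε)) (hF : ∀ ε, MemLp (F ε) (2 ^ n) μ) :
    2 * |gowersForm μ F| ≤ gowersForm μ (fun ε => F (Function.update ε i 0)) +
      gowersForm μ (fun ε => F (Function.update ε i 1)) := by
  obtain ⟨-, h⟩ := gowersForm_eq_integral μ i hm hF
  obtain ⟨i0, h0⟩ := gowersForm_eq_integral μ i (F := fun ε => F (Function.update ε i 0))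
    (fun ε => hm _) (fun ε => hF _)
  obtain ⟨i1, h1⟩ := gowersForm_eq_integral μ i (F := fun ε => F (Function.update ε i 1))
    (fun ε => hm _) (fun ε => hF _)
  simp only [Fin.update_insertNth] at i0 h0 i1 h1
  rw [h, h0, h1, ← integral_add i0 i1]
  refine (mul_le_mul_of_nonneg_left abs_integral_le_integral_abs zero_le_two).trans ?_
  rw [← integral_const_mul]
  refine integral_mono_of_nonneg (.of_forall fun t => by positivity) (i0.add i1)
    (.of_forall fun t => ?_)
  simp only [abs_mul]
  generalize cubeAvg μ (fun ε => F (i.insertNth (α := fun _ => Fin 2) 0 ε)) t = a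
  generalize cubeAvg μ (fun ε => F (i.insertNth (α := fun _ => Fin 2) 1 ε)) t = b
  nlinarith [sq_nonneg (|a| - |b|), abs_mul_abs_self a, abs_mul_abs_self b]

theorem gowersForm_const_nonneg {f : Y → ℝ} (hm : Measurable f) (hf : MemLp f (2 ^ n) μ) :
    0 ≤ gowersForm μ (fun _ : Fin (n + 1) → Fin 2 => f) :=
  gowersForm_update_nonneg μ 0 0 (F := fun _ => f) (fun _ => hm) fun _ => hf

/-- A form of the Cauchy-Schwarz-Gowers inequality. -/
theorem abs_gowersForm_ite_le_one {f h : Y → ℝ} (hmf : Measurable f) (hf : MemLp f (2 ^ n) μ)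
    (hmh : Measurable h) (hh : MemLp h (2 ^ n) μ)
    (hf1 : gowersForm μ (fun _ : Fin (n + 1) → Fin 2 => f) ≤ 1)
    (hh1 : gowersForm μ (fun _ : Fin (n + 1) → Fin 2 => h) ≤ 1) :
    |gowersForm μ (fun ε : Fin (n + 1) → Fin 2 => if ε = 0 then h else f)| ≤ 1 := by
  -- Interpolation over the set `S` of constrained coordinates: `S = ∅` puts `h` at every vertex, `S
  -- = univ` only at `0`.
  suffices H : ∀ S : Finset (Fin (n + 1)),
      |gowersForm μ (fun ε : Fin (n + 1) → Fin 2 => if ∀ i ∈ S, ε i = 0 then h else f)| ≤ 1 by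
    have h0 : (fun ε : Fin (n + 1) → Fin 2 => if ε = 0 then h else f) =
        fun ε => if ∀ i ∈ Finset.univ, ε i = 0 then h else f := by
      funext ε
      simp [funext_iff]
    rw [h0]
    exact H Finset.univ
  intro S
  induction S using Finset.induction_on with
  | empty => simpa [abs_le] using ⟨by linarith [gowersForm_const_nonneg μ hmh hh], hh1⟩
  | insert i S hi ih =>
    -- Freezing `ε i = 0` gives the form for `S`, freezing `ε i = 1` gives `f` at every vertex; both
    -- are at most 1.
    have := two_mul_abs_gowersForm_le μ i
      (F := fun ε => if ∀ j ∈ insert i S, ε j = 0 then h else f)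
      (fun ε => by split_ifs <;> assumption) (fun ε => by split_ifs <;> assumption)
    have h0 : ∀ ε : Fin (n + 1) → Fin 2, (∀ j ∈ insert i S, Function.update ε i 0 j = 0) ↔
        ∀ j ∈ S, ε j = 0 := fun ε => by
      simp only [Finset.forall_mem_insert, Function.update_self, true_and]
      refine forall₂_congr fun j hj => ?_
      rw [Function.update_of_ne (ne_of_mem_of_not_mem hj hi)]
    have h1 : ∀ ε : Fin (n + 1) → Fin 2,
        ¬ ∀ j ∈ insert i S, Function.update ε i 1 j = 0 := fun ε => by simp
    simp only [h0, h1, if_false] at this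
    linarith [le_abs_self (gowersForm μ
      (fun ε : Fin (n + 1) → Fin 2 => if ∀ i ∈ S, ε i = 0 then h else f))]

theorem integral_mul_dualAvg {f h : Y → ℝ} (hmf : Measurable f) (hf : MemLp f (2 ^ n) μ)
    (hmh : Measurable h) (hh : MemLp h (2 ^ n) μ) :
    ∫ x, h x * dualAvg μ (n + 1) f x ∂μ =
      gowersForm μ (fun ε : Fin (n + 1) → Fin 2 => if ε = 0 then h else f) := by
  have hI := integrable_prod μ (F := fun ε : Fin (n + 1) → Fin 2 => if ε = 0 then h else f)
    (fun ε => by split_ifs <;> assumption) (fun ε => by split_ifs <;> assumption)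
  rw [gowersForm, integral_prod _ hI]
  refine integral_congr_ae (.of_forall fun x => ?_)
  simp only [dualAvg, ← integral_const_mul, ite_apply, prod_ite_eq_zero, zero_dot, add_zero]

theorem prod_filter_ne_zero_one {M : Type*} [CommMonoid M] (a : (Fin 1 → Fin 2) → M) :
    ∏ ε with ε ≠ 0, a ε = a 1 := by
  rw [show (Finset.univ.filter fun ε : Fin 1 → Fin 2 => ε ≠ 0) = {1} by decide,
    Finset.prod_singleton]

theorem dualAvg_one {f : Y → ℝ} (hm : Measurable f) (x : Y) :
    dualAvg μ 1 f x = ∫ y, f y ∂μ := by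
  have hmp : MeasurePreserving (fun t : Fin 1 → Y => t 0) (Measure.pi fun _ => μ) μ :=
    measurePreserving_eval (fun _ : Fin 1 => μ) 0
  calc dualAvg μ 1 f x = ∫ t : Fin 1 → Y, f (x + t 0) ∂(Measure.pi fun _ => μ) := by
        simp [dualAvg, prod_filter_ne_zero_one, dot]
    _ = ∫ y, f (x + y) ∂(Measure.map (fun t : Fin 1 → Y => t 0) (Measure.pi fun _ => μ)) :=
        (integral_map hmp.aemeasurable
          (hm.comp (measurable_const_add x)).aestronglyMeasurable).symm
    _ = ∫ y, f y ∂μ := by rw [hmp.map_eq, integral_add_left_eq_self f x]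

/-- Placing a test function `k` at the vertex `0` in `lintegral_prod_le` bounds its pairing with `|D
f|` by a constant times `‖k‖_p`, and the converse Hölder inequality applies. At level 1, where `q =
∞`, the dual function is constant. -/
theorem memLp_dualAvg {f : Y → ℝ} (hm : Measurable f) (hf : MemLp f (expP (n + 1)) μ) :
    MemLp (dualAvg μ (n + 1) f) (expQ (n + 1)) μ := by
  have hD : Measurable (dualAvg μ (n + 1) f) :=
    (StronglyMeasurable.integral_prod_right
      (measurable_prod_comp_dot _ fun _ => hm).stronglyMeasurable).measurable
  rcases n with _ | n
  · rw [zero_add, expQ_one]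
    refine memLp_top_of_bound hD.aestronglyMeasurable |∫ x, f x ∂μ| (.of_forall fun x => ?_)
    rw [dualAvg_one μ hm, Real.norm_eq_abs]
  rw [expP_succ] at hf
  have hqt : expQ (n + 2) ≠ ∞ := ((expQ_le_two n).trans_lt (by simp)).ne
  refine memLp_of_forall_bounded (q := expP (n + 2)) hqt (expP_ne_top _) hD
    (C := ∏ ε : Fin (n + 2) → Fin 2 with ε ≠ 0,
      (∫⁻ x, ‖f x‖ₑ ^ (2 ^ (n + 1) : ℝ) ∂μ) ^ (1 / 2 ^ (n + 1) : ℝ)) ?_ fun k c hk hc hkc => ?_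
  · refine (ENNReal.prod_lt_top fun ε _ => ?_).ne
    have h := hf.2
    rw [eLpNorm_eq_lintegral_rpow_enorm_toReal (by simp) (by simp)] at h
    simpa using h
  · have hle := lintegral_prod_le μ (fun ε : Fin (n + 2) → Fin 2 => if ε = 0 then k else
      fun x => ‖f x‖ₑ) (fun ε => by split_ifs; exacts [hk, hm.enorm])
    have hR : ∏ ε : Fin (n + 2) → Fin 2,
        (∫⁻ x, (if ε = 0 then k x else ‖f x‖ₑ) ^ (2 ^ (n + 1) : ℝ) ∂μ) ^ (1 / 2 ^ (n + 1) : ℝ) =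
        (∏ ε : Fin (n + 2) → Fin 2 with ε ≠ 0,
          (∫⁻ x, ‖f x‖ₑ ^ (2 ^ (n + 1) : ℝ) ∂μ) ^ (1 / 2 ^ (n + 1) : ℝ)) *
        (∫⁻ x, k x ^ (2 ^ (n + 1) : ℝ) ∂μ) ^ (1 / 2 ^ (n + 1) : ℝ) := by
      rw [mul_comm, ← prod_ite_eq_zero (fun _ : Fin (n + 2) → Fin 2 =>
        (∫⁻ x, k x ^ (2 ^ (n + 1) : ℝ) ∂μ) ^ (1 / 2 ^ (n + 1) : ℝ))]
      refine Finset.prod_congr rfl fun ε _ => ?_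
      split_ifs <;> rfl
    have hmm : Measurable fun y : Y × (Fin (n + 2) → Y) =>
        k y.1 * ∏ ε : Fin (n + 2) → Fin 2 with ε ≠ 0, ‖f (y.1 + dot ε y.2)‖ₑ :=
      (hk.comp measurable_fst).mul (measurable_prod_comp_dot _ fun _ => hm.enorm)
    simp only [ite_apply] at hle
    rw [hR] at hle
    simp only [prod_ite_eq_zero, zero_dot, add_zero] at hle
    rw [lintegral_prod _ hmm.aemeasurable] at hle
    rw [expP_succ, ENNReal.toReal_pow, ENNReal.toReal_ofNat]
    refine le_trans (lintegral_mono fun x => ?_) hle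
    dsimp only
    rw [lintegral_const_mul]
    · gcongr
      refine (enorm_integral_le_lintegral_enorm _).trans_eq (lintegral_congr fun t => ?_)
      simp [enorm_eq_nnnorm, nnnorm_prod]
    · exact Finset.measurable_fun_prod _ fun ε _ =>
        (hm.comp ((measurable_dot ε).const_add x)).enorm

end form

/-! ### The Baire σ-algebra -/

/-- A copy of `Z`, for the σ-algebra of its Baire sets, generated by the continuous functions. The
addition of a compact group is measurable for the product of two copies of this σ-algebra, which
fails in general for the Borel sets. -/
def BaireCopy (Z : Type*) : Type _ := Z

namespace BaireCopy

variable {Z : Type*}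

instance [AddCommGroup Z] : AddCommGroup (BaireCopy Z) := inferInstanceAs (AddCommGroup Z)

/-- The identity, from the Baire copy. -/
def out (x : BaireCopy Z) : Z := x

instance [TopologicalSpace Z] : MeasurableSpace (BaireCopy Z) :=
  ⨆ c : C(Z, ℝ), MeasurableSpace.comap (fun x : BaireCopy Z => c x.out) (borel ℝ)

/-- The identity, as a homomorphism to the Baire copy. -/
def mkHom [AddCommGroup Z] : Z →+ BaireCopy Z := AddMonoidHom.id Z

variable [TopologicalSpace Z]

theorem measurable_iff {X : Type*} [MeasurableSpace X] {f : X → BaireCopy Z} :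
    Measurable f ↔ ∀ c : C(Z, ℝ), Measurable fun x => c (f x).out := by
  rw [measurable_iff_comap_le]
  change MeasurableSpace.comap f (⨆ c : C(Z, ℝ), _) ≤ _ ↔ _
  rw [MeasurableSpace.comap_iSup, iSup_le_iff]
  refine forall_congr' fun c => ?_
  rw [MeasurableSpace.comap_comp, measurable_iff_comap_le, BorelSpace.measurable_eq (α := ℝ)]
  rfl

theorem measurable_continuousMap (c : C(Z, ℝ)) : Measurable fun x : BaireCopy Z => c x.out :=
  measurable_iff.1 measurable_id c

variable [AddCommGroup Z]

/-- The identity of a power, as a homomorphism to a power of the Baire copy. -/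
def mkPiHom (d : ℕ) : (Fin d → Z) →+ (Fin d → BaireCopy Z) where
  toFun t i := mkHom (t i)
  map_zero' := rfl
  map_add' _ _ := rfl

theorem measurable_mkHom [MeasurableSpace Z] [BorelSpace Z] :
    Measurable (mkHom : Z →+ BaireCopy Z) :=
  measurable_iff.2 fun c => c.continuous.measurable

/-- Stone-Weierstrass: the functions with this property form a subalgebra of `C(Z × Z)` that
separates points, and measurability passes to limits. Applied to `c (x + y)`, it makes addition
measurable. -/
theorem measurable_prod_continuousMap [CompactSpace Z] [T2Space Z] (F : C(Z × Z, ℝ)) :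
    Measurable fun w : BaireCopy Z × BaireCopy Z => F (w.1.out, w.2.out) := by
  let A : Subalgebra ℝ C(Z × Z, ℝ) :=
    { carrier := {F | Measurable fun w : BaireCopy Z × BaireCopy Z => F (w.1.out, w.2.out)}
      mul_mem' := fun ha hb => Measurable.mul ha hb
      add_mem' := fun ha hb => Measurable.add ha hb
      algebraMap_mem' := fun r => measurable_const }
  have hA : A.SeparatesPoints := by
    have hsep : ∀ x y : Z, x ≠ y → ∃ c : C(Z, ℝ), c x ≠ c y := fun x y hxy => by
      obtain ⟨c, h0, h1, -⟩ := exists_continuous_zero_one_of_isClosed (isClosed_singleton (x := x))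
        (isClosed_singleton (x := y)) (by simpa using hxy)
      exact ⟨c, by rw [h0 rfl, h1 rfl]; simp⟩
    rintro ⟨x, y⟩ ⟨x', y'⟩ hne
    by_cases hx : x = x'
    · have hy : y ≠ y' := fun hy => hne (by rw [hx, hy])
      obtain ⟨c, hc⟩ := hsep y y' hy
      exact ⟨_, ⟨c.comp ContinuousMap.snd, (measurable_continuousMap c).comp measurable_snd, rfl⟩,
        hc⟩
    · obtain ⟨c, hc⟩ := hsep x x' hx
      exact ⟨_, ⟨c.comp ContinuousMap.fst, (measurable_continuousMap c).comp measurable_fst, rfl⟩,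
        hc⟩
  have htop := ContinuousMap.subalgebra_topologicalClosure_eq_top_of_separatesPoints A hA
  have hF : F ∈ closure (A : Set C(Z × Z, ℝ)) := by
    rw [← Subalgebra.topologicalClosure_coe, htop]; trivial
  obtain ⟨u, hu, hlim⟩ := mem_closure_iff_seq_limit.1 hF
  refine measurable_of_tendsto_metrizable hu (tendsto_pi_nhds.2 fun w => ?_)
  exact ((ContinuousEvalConst.continuous_eval_const (w.1.out, w.2.out)).tendsto F).comp hlim

variable [IsTopologicalAddGroup Z]

instance [CompactSpace Z] [T2Space Z] : MeasurableAdd₂ (BaireCopy Z) :=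
  ⟨measurable_iff.2 fun c => measurable_prod_continuousMap
    (c.comp ⟨fun w : Z × Z => w.1 + w.2, continuous_add⟩)⟩

instance : MeasurableNeg (BaireCopy Z) :=
  ⟨measurable_iff.2 fun c => measurable_continuousMap (c.comp ⟨fun x : Z => -x, continuous_neg⟩)⟩

end BaireCopy

/-! ### Haar measure on Borel and on Baire sets -/

section

variable {Z : Type*} [AddCommGroup Z] [TopologicalSpace Z] [IsTopologicalAddGroup Z]
  [CompactSpace Z]

instance isProbabilityMeasure_haarProb [MeasurableSpace Z] [BorelSpace Z] :
    IsProbabilityMeasure (haarProb Z) :=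
  ⟨by simpa using Measure.addHaarMeasure_self (K₀ := (⊤ : PositiveCompacts Z))⟩

theorem continuous_dot {Z : Type*} [AddCommGroup Z] [TopologicalSpace Z]
    [IsTopologicalAddGroup Z] {d : ℕ} (ε : Fin d → Fin 2) :
    Continuous (dot ε : (Fin d → Z) → Z) := by
  unfold dot; fun_prop

/-- With `L` a product of Baire copies, this turns `expect`, taken on the Borel sets of a power,
into an integral against a product measure, where Fubini is available. -/
theorem expect_eq_integral {L : Type*} [AddCommGroup L] [MeasurableSpace L] [MeasurableAdd₂ L]
    [MeasurableNeg L] (ν : Measure L) [IsProbabilityMeasure ν] [ν.IsAddLeftInvariant]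
    (φ : Z →+ L) (hφ : Measurable[borel Z] φ) (hs : Function.Surjective φ) {G : L → ℝ}
    (hG : Measurable G) : expect (fun z => G (φ z)) = ∫ y, G y ∂ν := by
  borelize Z
  have hmp := measurePreserving_of_surjective (haarProb Z) ν φ hφ hs
  rw [← hmp.map_eq, integral_map hmp.aemeasurable hG.aestronglyMeasurable]
  rfl

theorem expect_const_mul (c : ℝ) (F : Z → ℝ) : expect (fun z => c * F z) = c * expect F :=
  integral_const_mul _ _

variable [MeasurableSpace Z] [BorelSpace Z]

/-- The Haar probability measure on the Baire sets. -/
def baireProb (Z : Type*) [AddCommGroup Z] [TopologicalSpace Z] [IsTopologicalAddGroup Z]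
    [CompactSpace Z] [MeasurableSpace Z] [BorelSpace Z] : Measure (BaireCopy Z) :=
  (haarProb Z).map BaireCopy.mkHom

variable [T2Space Z]

instance : IsProbabilityMeasure (baireProb Z) :=
  Measure.isProbabilityMeasure_map BaireCopy.measurable_mkHom.aemeasurable

instance : (baireProb Z).IsAddLeftInvariant :=
  isAddLeftInvariant_map (BaireCopy.mkHom : Z →+ BaireCopy Z).toAddHom BaireCopy.measurable_mkHom
    Function.surjective_id

/-- Continuous functions are dense in `L^p` for `p ≠ ∞`, and the classes with an `m`-measurable
representative form a closed set. -/
theorem aestronglyMeasurable_of_forall_continuousMap {X : Type*} {m m0 : MeasurableSpace X}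
    [TopologicalSpace X] [CompactSpace X] [T2Space X] [BorelSpace X] (μ : Measure X)
    [IsFiniteMeasure μ] [μ.WeaklyRegular] (hm : m ≤ m0) (hc : ∀ c : C(X, ℝ), Measurable[m] c)
    {p : ℝ≥0∞} [Fact (1 ≤ p)] (hp : p ≠ ∞) (f : Lp ℝ p μ) : AEStronglyMeasurable[m] f μ := by
  refine (ContinuousMap.toLp_denseRange ℝ μ ℝ hp).induction_on
    (p := fun f => AEStronglyMeasurable[m] f μ) f (isClosed_aestronglyMeasurable hm) fun c => ?_
  exact ⟨c, (hc c).stronglyMeasurable, ContinuousMap.coeFn_toLp _ _⟩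

theorem exists_measurable_baire {p : ℝ≥0∞} [Fact (1 ≤ p)] (hp : p ≠ ∞)
    (f : Lp ℝ p (haarProb Z)) : ∃ g : BaireCopy Z → ℝ, Measurable g ∧
      MemLp g p (baireProb Z) ∧ f =ᵐ[haarProb Z] fun x => g (BaireCopy.mkHom x) := by
  have hm : MeasurableSpace.comap (BaireCopy.mkHom : Z →+ BaireCopy Z) inferInstance ≤
      ‹MeasurableSpace Z› := BaireCopy.measurable_mkHom.comap_le
  obtain ⟨g, hg, hfg⟩ := aestronglyMeasurable_of_forall_continuousMap (haarProb Z) hm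
    (fun c s hs => ⟨_, BaireCopy.measurable_continuousMap c hs, rfl⟩) hp f
  have hg' : Measurable fun x : BaireCopy Z => g x.out := fun s hs => by
    obtain ⟨t, ht, hts⟩ := hg.measurable hs
    have : (fun x : BaireCopy Z => g x.out) ⁻¹' s = t := hts.symm
    rwa [this]
  refine ⟨fun x => g x.out, hg', ?_, hfg⟩
  rw [baireProb, memLp_map_measure_iff hg'.aestronglyMeasurable
    BaireCopy.measurable_mkHom.aemeasurable]
  exact (memLp_congr_ae hfg).1 (Lp.memLp f)

end

/-! ### Gowers integrals and dual functions on `Z` -/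

section

variable {Z : Type*} [AddCommGroup Z] [TopologicalSpace Z] [IsTopologicalAddGroup Z]
  [CompactSpace Z] [MeasurableSpace Z] [BorelSpace Z]

/-- The integral whose root is the Gowers norm of level `d`. -/
def gowersIntegral (d : ℕ) (f : Z → ℝ) : ℝ :=
  expect fun y : Z × (Fin d → Z) => ∏ ε : Fin d → Fin 2, f (y.1 + dot ε y.2)

theorem gowersNorm_eq (d : ℕ) (f : Z → ℝ) :
    gowersNorm d f = gowersIntegral d f ^ (1 / (2 : ℝ) ^ d) := rfl

/-- Each surjective `ψ i` preserves Haar measure, so it pulls null sets back to null sets. For dual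
functions surjectivity uses `ε ≠ 0`, and the resulting equality holds at every `x`. -/
theorem expect_prod_congr_ae {K ι : Type*} [AddCommGroup K] [TopologicalSpace K]
    [IsTopologicalAddGroup K] [CompactSpace K] (s : Finset ι) (x : Z) (ψ : ι → K →+ Z)
    (hc : ∀ i ∈ s, Continuous (ψ i)) (hs : ∀ i ∈ s, Function.Surjective (ψ i)) {f g : Z → ℝ}
    (h : f =ᵐ[haarProb Z] g) :
    expect (fun k => ∏ i ∈ s, f (x + ψ i k)) = expect fun k => ∏ i ∈ s, g (x + ψ i k) := by
  borelize K
  refine integral_congr_ae ?_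
  have : ∀ i ∈ s, ∀ᵐ k ∂(haarProb K), f (x + ψ i k) = g (x + ψ i k) := fun i hi => by
    have hψ : MeasurePreserving (ψ i) (haarProb K) (haarProb Z) :=
      AddMonoidHom.measurePreserving (hc i hi) (hs i hi)
        (by rw [measure_univ, measure_univ])
    have hx : ∀ᵐ z ∂(haarProb Z), f (x + z) = g (x + z) :=
      (measurePreserving_add_left (haarProb Z) x).quasiMeasurePreserving.tendsto_ae.eventually
        (p := fun z => f z = g z) h
    exact hψ.quasiMeasurePreserving.tendsto_ae.eventually
      (p := fun z => f (x + z) = g (x + z)) hx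
  filter_upwards [s.eventually_all.2 this] with k hk
  exact Finset.prod_congr rfl hk

theorem gowersIntegral_congr_ae {d : ℕ} {f g : Z → ℝ} (h : f =ᵐ[haarProb Z] g) :
    gowersIntegral d f = gowersIntegral d g := by
  have := expect_prod_congr_ae (K := Z × (Fin d → Z)) Finset.univ (0 : Z)
    (fun ε : Fin d → Fin 2 => AddMonoidHom.fst Z _ + (dotHom ε).comp (AddMonoidHom.snd Z _))
    (fun ε _ => continuous_fst.add ((continuous_dot ε).comp continuous_snd))
    (fun ε _ z => ⟨(z, 0), by simp⟩) h
  simpa only [zero_add] using! this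

theorem dualFun_congr_ae {d : ℕ} {f g : Z → ℝ} (h : f =ᵐ[haarProb Z] g) (x : Z) :
    dualFun d f x = dualFun d g x :=
  expect_prod_congr_ae (K := Fin d → Z) (Finset.univ.filter fun ε : Fin d → Fin 2 => ε ≠ 0) x dotHom
    (fun ε _ => continuous_dot ε) (fun ε hε => dot_surjective (by simpa using hε)) h

theorem gowersIntegral_smul {d : ℕ} {p : ℝ≥0∞} (c : ℝ) (f : Lp ℝ p (haarProb Z)) :
    gowersIntegral d (c • f : Lp ℝ p (haarProb Z)) = c ^ 2 ^ d * gowersIntegral d f := by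
  rw [gowersIntegral_congr_ae (Lp.coeFn_smul c f), gowersIntegral, gowersIntegral,
    ← expect_const_mul]
  simp [Finset.prod_mul_distrib]

theorem dualFun_smul {d : ℕ} {p : ℝ≥0∞} (c : ℝ) (f : Lp ℝ p (haarProb Z)) (x : Z) :
    dualFun d (c • f : Lp ℝ p (haarProb Z)) x = c ^ (2 ^ d - 1) * dualFun d f x := by
  rw [dualFun_congr_ae (Lp.coeFn_smul c f), dualFun, dualFun, ← expect_const_mul]
  simp [Finset.prod_mul_distrib, Finset.filter_ne', Finset.card_erase_of_mem]

variable [T2Space Z]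

theorem gowersIntegral_eq_gowersForm {d : ℕ} {f : Z → ℝ} {g : BaireCopy Z → ℝ}
    (hg : Measurable g) (h : f =ᵐ[haarProb Z] fun x => g (BaireCopy.mkHom x)) :
    gowersIntegral d f = gowersForm (baireProb Z) (fun _ : Fin d → Fin 2 => g) := by
  rw [gowersIntegral_congr_ae h]
  refine expect_eq_integral ((baireProb Z).prod (Measure.pi fun _ : Fin d => baireProb Z))
    (BaireCopy.mkHom.prodMap (BaireCopy.mkPiHom d)) ?_ Function.surjective_id
    (G := fun y => ∏ ε : Fin d → Fin 2, g (y.1 + dot ε y.2))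
    (measurable_prod_comp_dot _ fun _ => hg)
  borelize (Z × (Fin d → Z))
  have h1 : Measurable fun w : Z × (Fin d → Z) => w.1 := continuous_fst.measurable
  have h2 : ∀ i, Measurable fun w : Z × (Fin d → Z) => w.2 i := fun i =>
    ((continuous_apply i).comp continuous_snd).measurable
  have hmk : Measurable (BaireCopy.mkHom : Z →+ BaireCopy Z) := BaireCopy.measurable_mkHom
  exact (hmk.comp h1).prodMk (measurable_pi_iff.2 fun i => hmk.comp (h2 i))

theorem dualFun_eq_dualAvg {d : ℕ} {f : Z → ℝ} {g : BaireCopy Z → ℝ}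
    (hg : Measurable g) (h : f =ᵐ[haarProb Z] fun x => g (BaireCopy.mkHom x)) (x : Z) :
    dualFun d f x = dualAvg (baireProb Z) d g (BaireCopy.mkHom x) := by
  rw [dualFun_congr_ae h]
  refine expect_eq_integral (Measure.pi fun _ : Fin d => baireProb Z)
    (BaireCopy.mkPiHom d) ?_ Function.surjective_id
    (G := fun t => ∏ ε : Fin d → Fin 2 with ε ≠ 0, g (BaireCopy.mkHom x + dot ε t)) ?_
  · borelize (Fin d → Z)
    have h2 : ∀ i, Measurable fun t : Fin d → Z => t i := fun i => (continuous_apply i).measurable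
    have hmk : Measurable (BaireCopy.mkHom : Z →+ BaireCopy Z) := BaireCopy.measurable_mkHom
    exact measurable_pi_iff.2 fun i => hmk.comp (h2 i)
  · exact Finset.measurable_fun_prod _ fun ε _ => hg.comp ((measurable_dot ε).const_add _)

variable {n : ℕ}

theorem memLp_dualFun (f : Lp ℝ (expP (n + 1)) (haarProb Z)) :
    MemLp (dualFun (n + 1) f) (expQ (n + 1)) (haarProb Z) := by
  obtain ⟨g, hg, hgp, hfg⟩ := exists_measurable_baire (expP_ne_top _) f
  have h := memLp_dualAvg (baireProb Z) hg hgp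
  simp only [funext (dualFun_eq_dualAvg hg hfg)]
  exact h.comp_of_map BaireCopy.measurable_mkHom.aemeasurable

theorem integral_mul_dualFun {f h : Lp ℝ (expP (n + 1)) (haarProb Z)} {g k : BaireCopy Z → ℝ}
    (hg : Measurable g) (hgp : MemLp g (expP (n + 1)) (baireProb Z))
    (hfg : f =ᵐ[haarProb Z] fun x => g (BaireCopy.mkHom x)) (hk : Measurable k)
    (hkp : MemLp k (expP (n + 1)) (baireProb Z))
    (hhk : h =ᵐ[haarProb Z] fun x => k (BaireCopy.mkHom x)) :
    ∫ x, h x * dualFun (n + 1) f x ∂(haarProb Z) =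
      gowersForm (baireProb Z) (fun ε : Fin (n + 1) → Fin 2 => if ε = 0 then k else g) := by
  have hD := (memLp_dualAvg (baireProb Z) hg hgp).aestronglyMeasurable
  rw [expP_succ] at hgp hkp
  rw [← integral_mul_dualAvg (baireProb Z) hg hgp hk hkp]
  simp only [dualFun_eq_dualAvg hg hfg]
  rw [integral_congr_ae (g := fun x => k (BaireCopy.mkHom x) *
    dualAvg (baireProb Z) (n + 1) g (BaireCopy.mkHom x))
    (by filter_upwards [hhk] with x hx; rw [hx])]
  exact (integral_map BaireCopy.measurable_mkHom.aemeasurable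
    (hk.aestronglyMeasurable.mul hD)).symm

theorem gowersIntegral_nonneg (f : Lp ℝ (expP (n + 1)) (haarProb Z)) :
    0 ≤ gowersIntegral (n + 1) f := by
  obtain ⟨g, hg, hgp, hfg⟩ := exists_measurable_baire (expP_ne_top _) f
  rw [gowersIntegral_eq_gowersForm hg hfg]
  rw [expP_succ] at hgp
  exact gowersForm_const_nonneg _ hg hgp

theorem gowersNorm_le_one_iff (f : Lp ℝ (expP (n + 1)) (haarProb Z)) :
    gowersNorm (n + 1) f ≤ 1 ↔ gowersIntegral (n + 1) f ≤ 1 := by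
  rw [gowersNorm_eq]
  have h0 := gowersIntegral_nonneg f
  refine ⟨fun h => ?_, fun h => Real.rpow_le_one h0 h (by positivity)⟩
  by_contra! hlt
  exact absurd h (not_le.2 (Real.one_lt_rpow hlt (by positivity)))

theorem integral_mul_dualFun_self (f : Lp ℝ (expP (n + 1)) (haarProb Z)) :
    ∫ x, f x * dualFun (n + 1) f x ∂(haarProb Z) = gowersIntegral (n + 1) f := by
  obtain ⟨g, hg, hgp, hfg⟩ := exists_measurable_baire (expP_ne_top _) f
  rw [gowersIntegral_eq_gowersForm hg hfg, integral_mul_dualFun hg hgp hfg hg hgp hfg]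
  simp only [ite_self]

theorem abs_integral_mul_dualFun_le_one {f h : Lp ℝ (expP (n + 1)) (haarProb Z)}
    (hf : gowersNorm (n + 1) f ≤ 1) (hh : gowersNorm (n + 1) h ≤ 1) :
    |∫ x, h x * dualFun (n + 1) f x ∂(haarProb Z)| ≤ 1 := by
  obtain ⟨g, hg, hgp, hfg⟩ := exists_measurable_baire (expP_ne_top _) f
  obtain ⟨k, hk, hkp, hhk⟩ := exists_measurable_baire (expP_ne_top _) h
  rw [gowersNorm_le_one_iff] at hf hh
  rw [gowersIntegral_eq_gowersForm hg hfg] at hf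
  rw [gowersIntegral_eq_gowersForm hk hhk] at hh
  rw [integral_mul_dualFun hg hgp hfg hk hkp hhk]
  rw [expP_succ] at hgp hkp
  exact abs_gowersForm_ite_le_one _ hg hgp hk hkp hf hh

theorem dualFun_one (f : Lp ℝ (expP 1) (haarProb Z)) (x : Z) :
    dualFun 1 f x = ∫ y, f y ∂(haarProb Z) := by
  obtain ⟨g, hg, hgp, hfg⟩ := exists_measurable_baire (expP_ne_top _) f
  rw [dualFun_eq_dualAvg hg hfg, dualAvg_one _ hg, integral_congr_ae hfg]
  exact integral_map BaireCopy.measurable_mkHom.aemeasurable hg.aestronglyMeasurable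

theorem gowersIntegral_one (f : Lp ℝ (expP 1) (haarProb Z)) :
    gowersIntegral 1 f = (∫ x, f x ∂(haarProb Z)) ^ 2 := by
  refine (integral_mul_dualFun_self (n := 0) f).symm.trans ?_
  simp only [zero_add, dualFun_one]
  rw [integral_mul_const, sq]

/-! ### The anti-uniform ball and the duality argument -/

/-- The pairing with a function in `L^p`, as a continuous linear functional on `L^q`. -/
def pairingCLM (d : ℕ) (f : Lp ℝ (expP d) (haarProb Z)) :
    Lp ℝ (expQ d) (haarProb Z) →L[ℝ] ℝ :=
  (ContinuousLinearMap.mul ℝ ℝ).lpPairing (haarProb Z) (expP d) (expQ d) f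

theorem pairing_eq (d : ℕ) (g : Lp ℝ (expQ d) (haarProb Z)) (f : Lp ℝ (expP d) (haarProb Z)) :
    pairing g f = pairingCLM d f g := by
  rw [pairingCLM, ContinuousLinearMap.lpPairing_eq_integral, pairing]
  simp [mul_comm]

theorem pairing_smul (d : ℕ) (g : Lp ℝ (expQ d) (haarProb Z)) (c : ℝ)
    (f : Lp ℝ (expP d) (haarProb Z)) :
    pairing g (c • f : Lp ℝ (expP d) (haarProb Z)) = c * pairing g f := by
  rw [pairing_eq, pairing_eq, pairingCLM, pairingCLM, map_smul]
  rfl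

theorem gowersNorm_smul_le_one (c : ℝ) {f : Lp ℝ (expP (n + 1)) (haarProb Z)}
    (hf : gowersIntegral (n + 1) f = 0) :
    gowersNorm (n + 1) (c • f : Lp ℝ (expP (n + 1)) (haarProb Z)) ≤ 1 := by
  rw [gowersNorm_le_one_iff, gowersIntegral_smul, hf]; simp

theorem gowersNorm_zero_smul_le_one (f : Lp ℝ (expP (n + 1)) (haarProb Z)) :
    gowersNorm (n + 1) ((0 : ℝ) • f : Lp ℝ (expP (n + 1)) (haarProb Z)) ≤ 1 := by
  rw [gowersNorm_le_one_iff, gowersIntegral_smul]; simp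

/-- The set of values contains the one at `f = 0`, so it is nonempty and its supremum is at most 1
once all its elements are. -/
theorem mem_antiUniformBall_iff {g : Lp ℝ (expQ (n + 1)) (haarProb Z)} :
    g ∈ antiUniformBall Z (n + 1) ↔
      ∀ f : Lp ℝ (expP (n + 1)) (haarProb Z), gowersNorm (n + 1) f ≤ 1 → |pairing g f| ≤ 1 := by
  constructor
  · rintro ⟨hb, hs⟩ f hf
    exact (le_csSup hb ⟨f, hf, rfl⟩).trans hs
  · intro h
    have hle : ∀ r ∈ dualValues (n + 1) g, r ≤ 1 := by
      rintro r ⟨f, hf, rfl⟩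
      exact h f hf
    exact ⟨⟨1, hle⟩, csSup_le ⟨_, (0 : ℝ) • 0, gowersNorm_zero_smul_le_one 0, rfl⟩ hle⟩

theorem antiUniformBall_eq_iInter : antiUniformBall Z (n + 1) =
    ⋂ (f : Lp ℝ (expP (n + 1)) (haarProb Z)) (_ : gowersNorm (n + 1) f ≤ 1),
      pairingCLM (n + 1) f ⁻¹' Set.Icc (-1) 1 := by
  ext g
  simp only [mem_antiUniformBall_iff, Set.mem_iInter, Set.mem_preimage, Set.mem_Icc, ← abs_le,
    pairing_eq]

theorem isClosed_antiUniformBall : IsClosed (antiUniformBall Z (n + 1)) := by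
  rw [antiUniformBall_eq_iInter]
  exact isClosed_iInter fun f => isClosed_iInter fun _ =>
    isClosed_Icc.preimage (pairingCLM (n + 1) f).continuous

theorem convex_antiUniformBall : Convex ℝ (antiUniformBall Z (n + 1)) := by
  rw [antiUniformBall_eq_iInter]
  exact convex_iInter fun f => convex_iInter fun _ =>
    (convex_Icc (-1 : ℝ) 1).linear_preimage (pairingCLM (n + 1) f).toLinearMap

theorem pairing_eq_zero {g : Lp ℝ (expQ (n + 1)) (haarProb Z)}
    (hg : g ∈ antiUniformBall Z (n + 1)) {f : Lp ℝ (expP (n + 1)) (haarProb Z)}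
    (hf : gowersIntegral (n + 1) f = 0) : pairing g f = 0 := by
  by_contra h0
  -- All multiples of `f` have Gowers norm at most 1; this one would pair with `g` to give 2.
  have h := mem_antiUniformBall_iff.1 hg _ (gowersNorm_smul_le_one (2 / pairing g f) hf)
  rw [pairing_smul, div_mul_cancel₀ _ h0] at h
  norm_num at h

/-- The set of dual functions of functions of Gowers norm at most one. -/
def dualSet (Z : Type*) [AddCommGroup Z] [TopologicalSpace Z] [IsTopologicalAddGroup Z]
    [CompactSpace Z] [MeasurableSpace Z] [BorelSpace Z] [T2Space Z] (n : ℕ) :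
    Set (Lp ℝ (expQ (n + 1)) (haarProb Z)) :=
  {g | ∃ f : Lp ℝ (expP (n + 1)) (haarProb Z), gowersNorm (n + 1) f ≤ 1 ∧
    g = (memLp_dualFun f).toLp (dualFun (n + 1) f)}

theorem dualSet_subset : dualSet Z n ⊆ antiUniformBall Z (n + 1) := by
  rintro _ ⟨f, hf, rfl⟩
  refine mem_antiUniformBall_iff.2 fun h hh => ?_
  have := abs_integral_mul_dualFun_le_one hf hh
  rwa [pairing, integral_congr_ae (g := fun x => h x * dualFun (n + 1) f x)]
  filter_upwards [(memLp_dualFun f).coeFn_toLp] with x hx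
  rw [hx, mul_comm]

/-- At level 1 the Gowers norm is `|∫ f|`, so `g` annihilates every function of mean zero. Hence `g`
is a constant `c`, testing against 1 gives `|c| ≤ 1`, and `c` is its own dual function. -/
theorem mem_dualSet_zero {g : Lp ℝ (expQ 1) (haarProb Z)} (hg : g ∈ antiUniformBall Z 1) :
    g ∈ dualSet Z 0 := by
  have hone : expP 1 ≤ expQ 1 := by rw [expQ_one]; exact le_top
  have hgL : MemLp g (expP 1) (haarProb Z) := (Lp.memLp g).mono_exponent hone
  have hg1 : MemLp g 2 (haarProb Z) := (Lp.memLp g).mono_exponent (by rw [expQ_one]; exact le_top)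
  have hgi : Integrable g (haarProb Z) := hg1.integrable (by norm_num)
  set c := ∫ x, g x ∂(haarProb Z) with hc
  have hcL : ∀ a : ℝ, MemLp (fun _ : Z => a) (expP 1) (haarProb Z) := fun a => memLp_const a
  have hcint : ∀ a : ℝ, ∫ x, (hcL a).toLp _ x ∂(haarProb Z) = a := fun a => by
    rw [integral_congr_ae (hcL a).coeFn_toLp]; simp
  have hdiff := hgL.sub (hcL c)
  have h0 : ∫ x, hdiff.toLp _ x ∂(haarProb Z) = 0 := by
    rw [integral_congr_ae hdiff.coeFn_toLp]
    simp only [Pi.sub_apply]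
    rw [integral_sub hgi (integrable_const c)]
    simp [hc]
  -- The variance of `g` vanishes: `g - c` has mean zero, so it is orthogonal both to `g` and to
  -- constants.
  have hzero : ∫ x, (g x - c) ^ 2 ∂(haarProb Z) = 0 := by
    have hp := pairing_eq_zero (n := 0) hg (f := hdiff.toLp _)
      ((gowersIntegral_one _).trans (by rw [h0]; norm_num))
    have hp' : ∫ x, g x * (g x - c) ∂(haarProb Z) = 0 := by
      rw [← hp]
      refine integral_congr_ae ?_
      filter_upwards [hdiff.coeFn_toLp] with x hx
      rw [hx]; rfl
    have h0' : ∫ x, c * (g x - c) ∂(haarProb Z) = 0 := by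
      rw [integral_const_mul, integral_sub hgi (integrable_const c)]
      simp [hc]
    have hi1 : Integrable (fun x => g x * (g x - c)) (haarProb Z) :=
      hg1.integrable_mul (hg1.sub (memLp_const c))
    have hi2 : Integrable (fun x => c * (g x - c)) (haarProb Z) :=
      (hgi.sub (integrable_const c)).const_mul c
    calc ∫ x, (g x - c) ^ 2 ∂(haarProb Z)
        = ∫ x, (g x * (g x - c) - c * (g x - c)) ∂(haarProb Z) := by congr 1; ext x; ring
      _ = 0 := by rw [integral_sub hi1 hi2, hp', h0', sub_zero]
  have hgc : g =ᵐ[haarProb Z] fun _ => c := by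
    have := (integral_eq_zero_iff_of_nonneg (fun x => sq_nonneg (g x - c))
      (hg1.sub (memLp_const c)).integrable_sq).1 hzero
    filter_upwards [this] with x hx
    have : (g x - c) ^ 2 = 0 := hx
    linarith [pow_eq_zero_iff (two_ne_zero) |>.1 this]
  have hc1 : |c| ≤ 1 := by
    have h := (mem_antiUniformBall_iff (n := 0)).1 hg ((hcL 1).toLp _)
      ((gowersNorm_le_one_iff _).2 ((gowersIntegral_one _).trans_le (by rw [hcint]; norm_num)))
    rwa [pairing, integral_congr_ae (g := g)] at h
    filter_upwards [(hcL 1).coeFn_toLp] with x hx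
    rw [hx, mul_one]
  refine ⟨(hcL c).toLp _, ?_, ?_⟩
  · refine (gowersNorm_le_one_iff _).2 ((gowersIntegral_one _).trans_le ?_)
    rw [hcint]
    exact (sq_le_one_iff_abs_le_one c).2 hc1
  · refine Lp.ext (hgc.trans ?_)
    filter_upwards [(memLp_dualFun (n := 0) ((hcL c).toLp _)).coeFn_toLp] with x hx
    rw [hx]
    exact ((dualFun_one _ x).trans (hcint c)).symm

theorem mem_closure_convexHull_dualSet {g : Lp ℝ (expQ (n + 2)) (haarProb Z)}
    (hg : g ∈ antiUniformBall Z (n + 2)) : g ∈ closure (convexHull ℝ (dualSet Z (n + 1))) := by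
  by_contra hn
  obtain ⟨φ, u, hφ, hu⟩ := geometric_hahn_banach_closed_point
    (convex_convexHull ℝ (dualSet Z (n + 1))).closure isClosed_closure hn
  obtain ⟨h, hh⟩ := exists_eq_integral_mul (p := expP (n + 2)) (haarProb Z) (expP_ne_top _)
    (expQ_le_two n) φ
  have hgφ : φ g = pairing g h := by
    rw [hh, pairing]; simp only [mul_comm]
  -- By homogeneity `φ` takes the value on the left at the dual function of `c • h`. The choice `c =
  -- 0` yields `0 < u`, and `c = s⁻¹` yields `s < u`, with `s` the Gowers norm of `h`.
  have hD : ∀ c : ℝ, gowersNorm (n + 2) (c • h : Lp ℝ (expP (n + 2)) (haarProb Z)) ≤ 1 →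
      c ^ (2 ^ (n + 2) - 1) * gowersIntegral (n + 2) h < u := by
    intro c hc
    have := hφ _ (subset_closure (subset_convexHull ℝ _ ⟨c • h, hc, rfl⟩))
    rw [hh, integral_congr_ae (g := fun x => c ^ (2 ^ (n + 2) - 1) * (h x * dualFun (n + 2) h x)),
      integral_const_mul, integral_mul_dualFun_self] at this
    · exact this
    · filter_upwards [(memLp_dualFun (c • h)).coeFn_toLp] with x hx
      rw [hx, dualFun_smul]; ring
  have hpos : 0 < u := by
    have := hD 0 (gowersNorm_zero_smul_le_one h)
    rwa [zero_pow, zero_mul] at this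
    have : 1 < 2 ^ (n + 2) := Nat.one_lt_two_pow (by omega)
    omega
  rw [hgφ] at hu
  rcases (gowersIntegral_nonneg h).eq_or_lt with h0 | h0
  · rw [pairing_eq_zero hg h0.symm] at hu
    exact absurd hu (not_lt.2 hpos.le)
  · set N := gowersIntegral (n + 2) h with hN
    set s : ℝ := N ^ (1 / (2 : ℝ) ^ (n + 2)) with hs
    have hs0 : 0 < s := Real.rpow_pos_of_pos h0 _
    have hsN : s ^ 2 ^ (n + 2) = N := by
      rw [hs, ← Real.rpow_natCast, ← Real.rpow_mul h0.le]
      simp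
    have hnorm : gowersNorm (n + 2) (s⁻¹ • h : Lp ℝ (expP (n + 2)) (haarProb Z)) ≤ 1 := by
      rw [gowersNorm_le_one_iff, gowersIntegral_smul, ← hN, ← hsN, ← mul_pow,
        inv_mul_cancel₀ hs0.ne', one_pow]
    have h1 := hD _ hnorm
    -- Anti-uniformity of `g` gives `⟨g ; h⟩ ≤ s`, against `s < u < ⟨g ; h⟩`.
    have h2 := le_of_abs_le (mem_antiUniformBall_iff.1 hg _ hnorm)
    rw [pairing_smul, inv_mul_le_iff₀ hs0, mul_one] at h2
    rw [← hsN, ← pow_sub_one_mul (pow_pos two_pos (n + 2)).ne' s, ← mul_assoc, ← mul_pow,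
      inv_mul_cancel₀ hs0.ne', one_pow, one_mul] at h1
    linarith

theorem antiUniformBall_eq (n : ℕ) :
    antiUniformBall Z (n + 1) = closure (convexHull ℝ (dualSet Z n)) := by
  refine Set.Subset.antisymm (fun g hg => ?_)
    (closure_minimal (convexHull_min dualSet_subset convex_antiUniformBall)
      isClosed_antiUniformBall)
  rcases n with _ | n
  · exact subset_closure (subset_convexHull ℝ _ (mem_dualSet_zero hg))
  · exact mem_closure_convexHull_dualSet hg

end

end

end Gowers

theorem mainTheorem6 {Z : Type*} [AddCommGroup Z] [TopologicalSpace Z] [IsTopologicalAddGroup Z]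
    [CompactSpace Z] [T2Space Z] [MeasurableSpace Z] [BorelSpace Z] (d : ℕ) (hd : 1 ≤ d) :
    ∃ hD : ∀ f : Lp ℝ (Gowers.expP d) (Gowers.haarProb Z),
        MemLp (Gowers.dualFun d f) (Gowers.expQ d) (Gowers.haarProb Z),
      Gowers.antiUniformBall Z d =
        closure (convexHull ℝ
          {g : Lp ℝ (Gowers.expQ d) (Gowers.haarProb Z) |
            ∃ f : Lp ℝ (Gowers.expP d) (Gowers.haarProb Z),
              Gowers.gowersNorm d f ≤ 1 ∧ g = (hD f).toLp (Gowers.dualFun d f)}) := by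
  obtain ⟨n, rfl⟩ : ∃ n, d = n + 1 := ⟨d - 1, by omega⟩
  exact ⟨Gowers.memLp_dualFun, Gowers.antiUniformBall_eq n⟩
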